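/- Slots are numbered $t=1,2,3,\dots$ and one packet is sent per slot. Fix an integer $l\ge 1$: the packet in slot $t$ is a coded packet if $l\mid t$ and an information packet otherwise, so one coded packet is inserted after every $l-1$ information packets. Each packet is erased independently with probability $\epsilon\in[0,1]$, and every received coded packet makes up for exactly one erased information packet. The stream is divided into consecutive periods, each beginning right after slot $0$ or after a coded slot, at a moment when no erasure is outstanding. Suppose a period begins after slot $a$. - If no information packet in the slots $a+1,\dots,a+l$ is erased, the period is idle; it consists of these $l$ slots, and its value is $0$. - Otherwise it is busy; it ends at the first coded slot $T=a+kl$, $k\ge1$, such that in the slots $a+1,\dots,T$ at least as many coded packets were received as information packets were erased. Its value is $k$, or $\infty$ if there is no such $T$, and then no further period begins. Let $S_j$ be the value of the $j$-th period. Fix $j$, write $S=S_j$, and let $S^+=\max\{S,1\}$, i.e. $S$ with the values $0$ and $1$ merged into $1$. **I.** If $l\epsilon<1$, then almost surely the $j$-th period begins and $S^+<\infty$, and the mean of the distribution of $S^+$ exists and is finite. **II.** For every $\epsilon\in[0,1]$, conditionally on the event that the $j$-th period begins (if this event has positive probability, as it always does for the first period and, for $l\epsilon<1$, for every period), the distribution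 of $S^+$ is given, for each integer $s\ge 0$, by \[ p_{S^+}(s)=\begin{cases}(l\epsilon+1-\epsilon)(1-\epsilon)^{l-1} & \text{for } s=1,\\[2pt] \dfrac{l-1}{s}\,\epsilon^{s}(1-\epsilon)^{s(l-1)}\dbinom{(s-1)l}{s-1} & \text{for } s>1,\\[2pt] 0 & \text{otherwise.}\end{cases} \] **III.** If $l\epsilon<1$, then \[ E(S^+)=\frac{(1-\epsilon)^{l}}{1-l\epsilon}. \] -/

import Mathlib

open MeasureTheory ProbabilityTheory

namespace StreamCode

/-! Slots are numbered `1, 2, 3, …`; a coded packet is sent in the slots divisible by `l`, an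
information packet in every other slot (so one coded packet follows every `l - 1` information
packets). An erasure pattern is a function `e : ℕ → Bool`, where `e t = true` means that the packet
sent in slot `t` is erased (`e 0` is never used). -/

/-- Number of erased information packets in the slots `a + 1, …, b`. -/
def infoErasures (l : ℕ) (e : ℕ → Bool) (a b : ℕ) : ℕ :=
  ((Finset.Ioc a b).filter fun t => ¬ l ∣ t ∧ e t = true).card

/-- Number of coded packets received (not erased) in the slots `a + 1, …, b`. -/
def codedReceived (l : ℕ) (e : ℕ → Bool) (a b : ℕ) : ℕ :=
  ((Finset.Ioc a b).filter fun t => l ∣ t ∧ e t = false).card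

/-- The value `S` of the period that begins just after the coded slot `a` (or at the beginning of
the stream, `a = 0`), at a moment when no erasure is outstanding.
If no information packet is erased in the next `l` slots, the period is idle and `S = 0`.
Otherwise it is busy, and in-order delivery resumes at the first coded slot `T = a + k * l` by which
as many coded packets have been received as information packets have been erased; then
`S = k = (T - a) / l`. If delivery never resumes, `S = ⊤` (infimum over the empty set). -/
noncomputable def busyTimeFrom (l : ℕ) (e : ℕ → Bool) (a : ℕ) : ℕ∞ :=
  if infoErasures l e a (a + l) = 0 then 0
  else ⨅ (k : ℕ) (_ : 1 ≤ k ∧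
    infoErasures l e a (a + k * l) ≤ codedReceived l e a (a + k * l)), (k : ℕ∞)

/-- The slot after which the `j`-th period (`j = 0, 1, 2, …`) begins. An idle period lasts `l` slots,
a busy period with value `S` lasts `S * l` slots. The value is `⊤` if some earlier period never
ends, so that there is no `j`-th period. -/
noncomputable def periodStart (l : ℕ) (e : ℕ → Bool) : ℕ → ℕ∞
  | 0 => 0
  | j + 1 =>
    if periodStart l e j = ⊤ ∨ busyTimeFrom l e (periodStart l e j).toNat = ⊤ then ⊤
    else if busyTimeFrom l e (periodStart l e j).toNat = 0 then periodStart l e j + l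
    else periodStart l e j + busyTimeFrom l e (periodStart l e j).toNat * l

/-- The value `S_j` of the `j`-th period; meaningful only if that period begins, i.e. if
`periodStart l e j ≠ ⊤`. -/
noncomputable def busyTime (l : ℕ) (e : ℕ → Bool) (j : ℕ) : ℕ∞ :=
  busyTimeFrom l e (periodStart l e j).toNat

/-- `S_j⁺`: the value `S_j` with the values `0` and `1` merged into `1`. -/
noncomputable def busyTimePlus (l : ℕ) (e : ℕ → Bool) (j : ℕ) : ℕ∞ :=
  max (busyTime l e j) 1

end StreamCode

/-! An erased coded packet leaves one information erasure uncorrected that it would otherwise have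
corrected, so it costs exactly as much as an erased information packet. Hence `S⁺` is the first
`k ≥ 1` such that at most `k` packets of either kind are erased in the first `k` blocks of `l` slots
(`lt_busyTimePlusFrom_iff`); this covers idle periods too. The numbers of erasures in successive
blocks are independent and binomial, so `S⁺` is a first passage time of a random walk that moves by
`b - 1` in a block with `b` erasures: after a first block with `b` erasures it remains to descend
from height `b - 1` to `0`.

The probability `survival ε l n h` that the walk from height `h` is still positive after `n` blocks
satisfies a recursion on the first block. By induction, Vandermonde's identity and the
hypergeometric mean give the hitting time theorem `survival_sub_survival_succ`, and averaging it
over the first block gives the mass function of `S⁺` (`periodSurvival_zero_sub_one`,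
`periodSurvival_sub_succ`). If `l * ε < 1`, the stopped walk, compensated for its drift
`l * ε - 1`, is a martingale; this bounds the sum of the tail probabilities, and as that sum converges
nothing of the height is left in the limit, so the mean hitting time from `h` is `h / (1 - l * ε)`
(`hasSum_survival`, `hasSum_periodSurvival`).

The beginnings of periods are stopping times (`determinedBy_periodStart_eq`), so a period that
begins has the law of `S⁺` for a period beginning at slot `0`
(`IsErasureProcess.measure_periodStart_ne_top_and_lt`). When `l * ε < 1`, each period therefore
ends almost surely and the next one begins. -/

namespace StreamCode

/-! ### Binomial weights -/

/-- The probability `C(N, k) ε ^ k (1 - ε) ^ (N - k)` of exactly `k` erasures in `N` slots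
(zero for `k > N`). -/
def binomialWeight (ε : ℝ) (N k : ℕ) : ℝ :=
  (N.choose k : ℝ) * ε ^ k * (1 - ε) ^ (N - k)

lemma binomialWeight_of_lt (ε : ℝ) {N k : ℕ} (h : N < k) : binomialWeight ε N k = 0 := by
  simp [binomialWeight, Nat.choose_eq_zero_of_lt h]

lemma binomialWeight_nonneg {ε : ℝ} (h0 : 0 ≤ ε) (h1 : ε ≤ 1) (N k : ℕ) :
    0 ≤ binomialWeight ε N k := by
  have : 0 ≤ 1 - ε := by linarith
  unfold binomialWeight
  positivity

lemma binomialWeight_zero_right (ε : ℝ) (N : ℕ) : binomialWeight ε N 0 = (1 - ε) ^ N := by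
  simp [binomialWeight]

lemma binomialWeight_succ_zero (ε : ℝ) (N : ℕ) :
    binomialWeight ε (N + 1) 0 = binomialWeight ε N 0 * (1 - ε) := by
  simp [binomialWeight, pow_succ]

lemma binomialWeight_succ_succ (ε : ℝ) (N k : ℕ) :
    binomialWeight ε (N + 1) (k + 1) =
      binomialWeight ε N k * ε + binomialWeight ε N (k + 1) * (1 - ε) := by
  simp only [binomialWeight, Nat.choose_succ_succ, Nat.cast_add, Nat.add_sub_add_right]
  rcases Nat.lt_or_ge k N with h | h
  · obtain ⟨m, rfl⟩ := Nat.exists_eq_add_of_lt h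
    rw [show k + m + 1 - k = m + 1 by omega, show k + m + 1 - (k + 1) = m by omega]
    ring
  · rw [Nat.choose_eq_zero_of_lt (show N < k + 1 by omega)]
    push_cast
    ring

lemma sum_binomialWeight (ε : ℝ) (N : ℕ) :
    ∑ k ∈ Finset.range (N + 1), binomialWeight ε N k = 1 := by
  have h := congrArg (Polynomial.eval ε) (bernsteinPolynomial.sum ℝ N)
  simpa [Polynomial.eval_finsetSum, bernsteinPolynomial, binomialWeight] using h

lemma one_sub_sum_binomialWeight_mul (ε : ℝ) (N : ℕ) (φ : ℕ → ℝ) :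
    1 - ∑ b ∈ Finset.range (N + 1), binomialWeight ε N b * φ b =
      ∑ b ∈ Finset.range (N + 1), binomialWeight ε N b * (1 - φ b) := by
  simp only [mul_one_sub, Finset.sum_sub_distrib]
  rw [sum_binomialWeight]

lemma sum_binomialWeight_mul_cast (ε : ℝ) (N : ℕ) :
    ∑ k ∈ Finset.range (N + 1), binomialWeight ε N k * (k : ℝ) = N * ε := by
  have h := congrArg (Polynomial.eval ε) (bernsteinPolynomial.sum_smul ℝ N)
  simp only [Polynomial.eval_finsetSum, bernsteinPolynomial, nsmul_eq_mul, Polynomial.eval_mul,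
    Polynomial.eval_natCast, Polynomial.eval_pow, Polynomial.eval_X, Polynomial.eval_sub,
    Polynomial.eval_one] at h
  rw [← h]
  exact Finset.sum_congr rfl fun k _ => by rw [binomialWeight]; ring

lemma binomialWeight_mul (ε : ℝ) (N M i j : ℕ) :
    binomialWeight ε N i * binomialWeight ε M j =
      ((N.choose i * M.choose j : ℕ) : ℝ) * (ε ^ (i + j) * (1 - ε) ^ (N + M - (i + j))) := by
  rcases Nat.lt_or_ge N i with h | h
  · simp [binomialWeight, Nat.choose_eq_zero_of_lt h]
  rcases Nat.lt_or_ge M j with h' | h'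
  · simp [binomialWeight, Nat.choose_eq_zero_of_lt h']
  rw [show N + M - (i + j) = (N - i) + (M - j) by omega, binomialWeight, binomialWeight]
  push_cast
  ring

/-- Vandermonde's identity: the number of erasures in `N + M` slots is the sum of those in the first
`N` and in the last `M`. -/
lemma sum_binomialWeight_mul_binomialWeight (ε : ℝ) (N M k : ℕ) :
    ∑ i ∈ Finset.range (k + 1), binomialWeight ε N i * binomialWeight ε M (k - i) =
      binomialWeight ε (N + M) k := by
  rw [binomialWeight, Nat.add_choose_eq, Finset.Nat.sum_antidiagonal_eq_sum_range_succ
    (fun i j => N.choose i * M.choose j), Nat.cast_sum, mul_assoc, Finset.sum_mul]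
  refine Finset.sum_congr rfl fun i hi => ?_
  have : i ≤ k := by simpa [Nat.lt_succ_iff] using hi
  rw [binomialWeight_mul, Nat.add_sub_cancel' this]

lemma sum_choose_mul_choose_mul (N M k : ℕ) :
    (N + M) * ∑ i ∈ Finset.range (k + 1), N.choose i * M.choose (k - i) * i =
      N * k * (N + M).choose k := by
  rcases k with _ | k
  · simp
  rcases N with _ | N
  · suffices h : ∑ i ∈ Finset.range (k + 1 + 1), (0 : ℕ).choose i * M.choose (k + 1 - i) * i = 0 by
      simp [h]
    refine Finset.sum_eq_zero fun i _ => ?_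
    rcases i with _ | i <;> simp
  have h1 : ∑ i ∈ Finset.range (k + 1 + 1), (N + 1).choose i * M.choose (k + 1 - i) * i =
      (N + 1) * (N + M).choose k := by
    rw [Finset.sum_range_succ', Nat.add_choose_eq N M k,
      Finset.Nat.sum_antidiagonal_eq_sum_range_succ (fun i j => N.choose i * M.choose j),
      Finset.mul_sum]
    simp only [mul_zero, add_zero, Nat.succ_eq_add_one]
    refine Finset.sum_congr rfl fun i _ => ?_
    rw [Nat.add_sub_add_right, ← mul_assoc, Nat.add_one_mul_choose_eq]
    ring
  rw [h1, mul_left_comm, show N + 1 + M = N + M + 1 by ring, Nat.add_one_mul_choose_eq]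
  ring

/-- The hypergeometric mean: given `k` erasures in `N + M` slots, the first `N` slots contain on
average a proportion `N / (N + M)` of them. -/
lemma sum_binomialWeight_mul_binomialWeight_mul_cast (ε : ℝ) (N M k : ℕ) :
    ((N : ℝ) + M) *
        ∑ i ∈ Finset.range (k + 1), binomialWeight ε N i * binomialWeight ε M (k - i) * (i : ℝ) =
      N * k * binomialWeight ε (N + M) k := by
  have h := congrArg (Nat.cast (R := ℝ)) (sum_choose_mul_choose_mul N M k)
  push_cast at h
  rw [binomialWeight, mul_assoc _ _ ((1 - ε) ^ _), ← mul_assoc, ← h, mul_assoc, Finset.sum_mul]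
  congr 1
  refine Finset.sum_congr rfl fun i hi => ?_
  have : i ≤ k := by simpa [Nat.lt_succ_iff] using hi
  rw [binomialWeight_mul, Nat.add_sub_cancel' this]
  push_cast
  ring

/-- A sum against binomial weights may be cut off at any point beyond which the integrand
vanishes. -/
lemma sum_binomialWeight_mul_eq (ε : ℝ) (N k : ℕ) (φ : ℕ → ℝ) (hφ : ∀ b, k < b → φ b = 0) :
    ∑ b ∈ Finset.range (N + 1), binomialWeight ε N b * φ b =
      ∑ b ∈ Finset.range (k + 1), binomialWeight ε N b * φ b := by
  have key : ∀ m ≤ N + k, (∀ b, m < b → binomialWeight ε N b * φ b = 0) →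
      ∑ b ∈ Finset.range (m + 1), binomialWeight ε N b * φ b =
        ∑ b ∈ Finset.range (N + k + 1), binomialWeight ε N b * φ b := fun m hmk hm =>
    Finset.sum_subset (Finset.range_subset_range.2 (by omega)) fun b _ hb =>
      hm b (by simpa [Nat.succ_le_iff] using hb)
  rw [key N (Nat.le_add_right N k) fun b hb => by rw [binomialWeight_of_lt ε hb, zero_mul],
    key k (Nat.le_add_left k N) fun b hb => by rw [hφ b hb, mul_zero]]

/-! ### The survival function of the random walk -/

/-- A walk starts at height `h` and moves in each block by `b - 1`, where `b` is the binomially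
distributed number of erasures among the `l` slots of the block. `survival ε l n h` is the
probability that it is still positive after `0, 1, …, n` blocks, by recursion on the first block. -/
def survival (ε : ℝ) (l : ℕ) : ℕ → ℕ → ℝ
  | _, 0 => 0
  | 0, _ + 1 => 1
  | n + 1, h + 1 => ∑ b ∈ Finset.range (l + 1), binomialWeight ε l b * survival ε l n (h + b)

@[simp] lemma survival_zero_right (ε : ℝ) (l n : ℕ) : survival ε l n 0 = 0 := by
  cases n <;> rfl

@[simp] lemma survival_zero_succ (ε : ℝ) (l h : ℕ) : survival ε l 0 (h + 1) = 1 := rfl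

lemma survival_succ_succ (ε : ℝ) (l n h : ℕ) :
    survival ε l (n + 1) (h + 1) =
      ∑ b ∈ Finset.range (l + 1), binomialWeight ε l b * survival ε l n (h + b) := rfl

/-- The hitting time theorem: from height `h`, the walk reaches `0` after exactly `n + 1` blocks
with probability `h / (n + 1)` times the probability of `n + 1 - h` erasures in `l * (n + 1)` slots. -/
lemma survival_sub_survival_succ (ε : ℝ) {l : ℕ} (hl : 1 ≤ l) (n h : ℕ) :
    ((n : ℝ) + 1) * (survival ε l n h - survival ε l (n + 1) h) =
      if h ≤ n + 1 then h * binomialWeight ε (l * (n + 1)) (n + 1 - h) else 0 := by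
  induction n generalizing h with
  | zero =>
    rcases h with _ | h
    · simp
    rw [survival_zero_succ, survival_succ_succ, one_sub_sum_binomialWeight_mul,
      sum_binomialWeight_mul_eq ε l 0 (fun b => 1 - survival ε l 0 (h + b)) fun b hb => by
      obtain ⟨c, rfl⟩ := Nat.exists_eq_add_of_lt hb
      rw [show h + (0 + c + 1) = (h + c) + 1 by ring, survival_zero_succ, sub_self]]
    rcases h with _ | h <;> simp
  | succ n ih =>
    rcases h with _ | h
    · simp
    have hn : (n : ℝ) + 1 ≠ 0 := by positivity
    have hlr : (l : ℝ) ≠ 0 := by exact_mod_cast (by omega : l ≠ 0)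
    have step : ((n : ℝ) + 1) * (survival ε l (n + 1) (h + 1) - survival ε l (n + 1 + 1) (h + 1)) =
        ∑ b ∈ Finset.range (l + 1), binomialWeight ε l b *
          (if h + b ≤ n + 1 then
            ((h + b : ℕ) : ℝ) * binomialWeight ε (l * (n + 1)) (n + 1 - (h + b)) else 0) := by
      simp only [← ih]
      rw [survival_succ_succ, survival_succ_succ, ← Finset.sum_sub_distrib, Finset.mul_sum]
      exact Finset.sum_congr rfl fun b _ => by ring
    by_cases hh : h ≤ n + 1
    -- To reach `0` after `n + 2` blocks, the walk from height `h + 1` needs `k` erasures.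
    · obtain ⟨k, hk⟩ := Nat.exists_eq_add_of_le hh
      have hV := sum_binomialWeight_mul_binomialWeight ε l (l * (n + 1)) k
      have hM := sum_binomialWeight_mul_binomialWeight_mul_cast ε l (l * (n + 1)) k
      have hsum : ∑ b ∈ Finset.range (l + 1), binomialWeight ε l b *
          (if h + b ≤ n + 1 then
            ((h + b : ℕ) : ℝ) * binomialWeight ε (l * (n + 1)) (n + 1 - (h + b)) else 0) =
          h * binomialWeight ε (l + l * (n + 1)) k + ∑ i ∈ Finset.range (k + 1),
            binomialWeight ε l i * binomialWeight ε (l * (n + 1)) (k - i) * (i : ℝ) := by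
        rw [sum_binomialWeight_mul_eq ε l k _ fun b hb => if_neg (by omega), ← hV,
          Finset.mul_sum, ← Finset.sum_add_distrib]
        refine Finset.sum_congr rfl fun b hb => ?_
        have : b ≤ k := by simpa [Nat.lt_succ_iff] using hb
        rw [if_pos (by omega), show n + 1 - (h + b) = k - b by omega]
        push_cast
        ring
      have hkr : (k : ℝ) = n + 1 - h := by
        have : ((n + 1 : ℕ) : ℝ) = ((h + k : ℕ) : ℝ) := congrArg _ hk
        push_cast at this
        linarith
      have hM' : ((n : ℝ) + 1 + 1) * ∑ i ∈ Finset.range (k + 1),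
            binomialWeight ε l i * binomialWeight ε (l * (n + 1)) (k - i) * (i : ℝ) =
          k * binomialWeight ε (l + l * (n + 1)) k := by
        apply mul_left_cancel₀ hlr
        push_cast at hM
        linear_combination hM
      rw [if_pos (by omega), show n + 1 + 1 - (h + 1) = k by omega,
        show l * (n + 1 + 1) = l + l * (n + 1) by ring]
      apply mul_left_cancel₀ hn
      rw [mul_left_comm, step, hsum, mul_add, Nat.cast_add_one n, hM', hkr]
      push_cast
      ring
    · rw [if_neg (by omega)]
      rw [Finset.sum_eq_zero fun b _ => by rw [if_neg (by omega), mul_zero]] at step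
      rw [(mul_eq_zero.1 step).resolve_left hn, mul_zero]

lemma survival_nonneg {ε : ℝ} (h0 : 0 ≤ ε) (h1 : ε ≤ 1) (l n h : ℕ) : 0 ≤ survival ε l n h := by
  induction n generalizing h with
  | zero => rcases h with _ | h <;> simp
  | succ n ih =>
    rcases h with _ | h
    · simp
    exact Finset.sum_nonneg fun b _ => mul_nonneg (binomialWeight_nonneg h0 h1 l b) (ih _)

/-- The quantity between the bounds is the mean height after `n` blocks of the walk stopped at `0`,
computed from its drift `l * ε - 1` per block; the height is nonnegative and at most `h + l * n`. -/
lemma stopped_mean_bounds {ε : ℝ} (h0 : 0 ≤ ε) (h1 : ε ≤ 1) (l n h : ℕ) :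
    0 ≤ h - (1 - l * ε) * ∑ k ∈ Finset.range n, survival ε l k h ∧
      h - (1 - l * ε) * ∑ k ∈ Finset.range n, survival ε l k h ≤
        (h + l * n) * survival ε l n h := by
  induction n generalizing h with
  | zero => rcases h with _ | h <;> simp; positivity
  | succ n ih =>
    rcases h with _ | h
    · simp
    have key : ((h + 1 : ℕ) : ℝ) -
          (1 - l * ε) * ∑ k ∈ Finset.range (n + 1), survival ε l k (h + 1) =
        ∑ b ∈ Finset.range (l + 1), binomialWeight ε l b * (((h + b : ℕ) : ℝ) -
          (1 - l * ε) * ∑ k ∈ Finset.range n, survival ε l k (h + b)) := by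
      have e1 : ∑ k ∈ Finset.range n, survival ε l (k + 1) (h + 1) =
          ∑ b ∈ Finset.range (l + 1),
            binomialWeight ε l b * ∑ k ∈ Finset.range n, survival ε l k (h + b) := by
        simp only [survival_succ_succ, Finset.mul_sum]
        exact Finset.sum_comm
      have e2 : ∑ b ∈ Finset.range (l + 1), binomialWeight ε l b * ((h + b : ℕ) : ℝ) =
          h + l * ε := by
        simp only [Nat.cast_add, mul_add, Finset.sum_add_distrib]
        rw [← Finset.sum_mul, sum_binomialWeight, sum_binomialWeight_mul_cast, one_mul]
      rw [Finset.sum_range_succ', survival_zero_succ, e1]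
      simp only [mul_sub, Finset.sum_sub_distrib]
      rw [e2]
      simp only [mul_left_comm _ (1 - (l : ℝ) * ε), ← Finset.mul_sum]
      push_cast
      ring
    rw [key]
    constructor
    · exact Finset.sum_nonneg fun b _ => mul_nonneg (binomialWeight_nonneg h0 h1 l b) (ih _).1
    · rw [survival_succ_succ, Finset.mul_sum]
      refine Finset.sum_le_sum fun b hb => ?_
      rw [mul_left_comm]
      refine mul_le_mul_of_nonneg_left ((ih _).2.trans ?_) (binomialWeight_nonneg h0 h1 l b)
      refine mul_le_mul_of_nonneg_right ?_ (survival_nonneg h0 h1 l n _)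
      have : (b : ℝ) ≤ l := by exact_mod_cast (by simpa [Nat.lt_succ_iff] using hb : b ≤ l)
      push_cast
      linarith

/-- Below the critical erasure rate, the mean time at which the walk reaches `0` from height `h` is
`h / (1 - l * ε)`. -/
lemma hasSum_survival {ε : ℝ} (h0 : 0 ≤ ε) (h1 : ε ≤ 1) {l : ℕ} (hlt : (l : ℝ) * ε < 1) (h : ℕ) :
    HasSum (fun n => survival ε l n h) (h / (1 - l * ε)) := by
  have hδ : 0 < 1 - (l : ℝ) * ε := by linarith
  have hnn := fun n => survival_nonneg h0 h1 l n h
  have hle : ∀ n, ∑ k ∈ Finset.range n, survival ε l k h ≤ h / (1 - l * ε) := fun n => by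
    rw [le_div_iff₀' hδ]
    linarith [(stopped_mean_bounds h0 h1 l n h).1]
  have hs : Summable fun n => survival ε l n h := summable_of_sum_range_le hnn hle
  refine hs.hasSum_iff.2 (le_antisymm (Real.tsum_le_of_sum_range_le hnn hle) ?_)
  by_contra! hlt'
  rw [lt_div_iff₀' hδ, ← sub_pos] at hlt'
  set d := (h : ℝ) - (1 - l * ε) * ∑' n, survival ε l n h with hd
  -- If mass stayed behind, the survival function would dominate a multiple of the harmonic series.
  have hlow : ∀ n : ℕ, d / (h + l + 1) * (1 / ((n + 1 : ℕ) : ℝ)) ≤ survival ε l n h := fun n => by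
    have hb := (stopped_mean_bounds h0 h1 l n h).2
    have hp : (1 - l * ε) * ∑ k ∈ Finset.range n, survival ε l k h ≤
        (1 - l * ε) * ∑' n, survival ε l n h :=
      mul_le_mul_of_nonneg_left (hs.sum_le_tsum _ fun i _ => hnn i) hδ.le
    have hc : ((h : ℝ) + l * n) ≤ (h + l + 1) * ((n + 1 : ℕ) : ℝ) := by
      push_cast
      have h3 : (0 : ℝ) ≤ h * n := by positivity
      have h4 : (0 : ℝ) ≤ l := by positivity
      have h5 : (0 : ℝ) ≤ n := by positivity
      linarith
    rw [div_mul_div_comm, mul_one, div_le_iff₀' (by positivity)]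
    calc d ≤ (h + l * n) * survival ε l n h := by linarith
      _ ≤ _ := mul_le_mul_of_nonneg_right hc (hnn n)
  have hsum : Summable fun n : ℕ => d / (h + l + 1) * (1 / ((n + 1 : ℕ) : ℝ)) :=
    Summable.of_nonneg_of_le (fun n => by positivity) hlow hs
  rw [summable_mul_left_iff (by positivity)] at hsum
  exact Real.not_summable_one_div_natCast
    ((summable_nat_add_iff (f := fun n : ℕ => 1 / (n : ℝ)) 1).1 hsum)

/-! ### The survival function of a period -/

/-- The probability that `S⁺ > n`. After a first block with `b` erasures the walk stands at height
`b - 1`; truncated subtraction is harmless, as the period is over if `b ≤ 1`. -/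
def periodSurvival (ε : ℝ) (l : ℕ) : ℕ → ℝ
  | 0 => 1
  | n + 1 => ∑ b ∈ Finset.range (l + 1), binomialWeight ε l b * survival ε l n (b - 1)

lemma periodSurvival_zero_sub_one (ε : ℝ) {l : ℕ} (hl : 1 ≤ l) :
    periodSurvival ε l 0 - periodSurvival ε l 1 = (l * ε + 1 - ε) * (1 - ε) ^ (l - 1) := by
  rw [periodSurvival, periodSurvival, one_sub_sum_binomialWeight_mul,
    sum_binomialWeight_mul_eq ε l 1 (fun b => 1 - survival ε l 0 (b - 1)) fun b hb => by
    obtain ⟨c, rfl⟩ := Nat.exists_eq_add_of_lt hb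
    rw [show 1 + c + 1 - 1 = c + 1 by omega, survival_zero_succ, sub_self]]
  obtain ⟨m, rfl⟩ := Nat.exists_eq_add_of_le' hl
  simp [Finset.sum_range_succ, binomialWeight]
  ring

lemma periodSurvival_sub_succ (ε : ℝ) {l : ℕ} (hl : 1 ≤ l) (n : ℕ) :
    periodSurvival ε l (n + 1) - periodSurvival ε l (n + 2) =
      ((l : ℝ) - 1) / ((n + 2 : ℕ) : ℝ) * ε ^ (n + 2) * (1 - ε) ^ ((n + 2) * (l - 1)) *
        (((n + 1) * l).choose (n + 1) : ℝ) := by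
  have hn : (n : ℝ) + 1 ≠ 0 := by positivity
  have hlr : (l : ℝ) ≠ 0 := by exact_mod_cast (by omega : l ≠ 0)
  have hM := sum_binomialWeight_mul_binomialWeight_mul_cast ε l (l * (n + 1)) (n + 2)
  have hV := sum_binomialWeight_mul_binomialWeight ε l (l * (n + 1)) (n + 2)
  have hM' : ∑ i ∈ Finset.range (n + 2 + 1), binomialWeight ε l i *
        binomialWeight ε (l * (n + 1)) (n + 2 - i) * (i : ℝ) =
      binomialWeight ε (l + l * (n + 1)) (n + 2) := by
    have h2 : (l : ℝ) * (n + 2) ≠ 0 := by positivity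
    apply mul_left_cancel₀ h2
    push_cast at hM
    linear_combination hM
  have step : ((n : ℝ) + 1) * (periodSurvival ε l (n + 1) - periodSurvival ε l (n + 2)) =
      ∑ b ∈ Finset.range (l + 1), binomialWeight ε l b * (if b - 1 ≤ n + 1 then
        ((b - 1 : ℕ) : ℝ) * binomialWeight ε (l * (n + 1)) (n + 1 - (b - 1)) else 0) := by
    simp only [← survival_sub_survival_succ ε hl]
    rw [periodSurvival, periodSurvival, ← Finset.sum_sub_distrib, Finset.mul_sum]
    exact Finset.sum_congr rfl fun b _ => by ring
  -- Given `n + 2` erasures in `n + 2` blocks, the mean of `b - 1` over the first block is zero, so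
  -- only the truncation of `b - 1` at `b = 0` contributes.
  have hsum : ((n : ℝ) + 1) * (periodSurvival ε l (n + 1) - periodSurvival ε l (n + 2)) =
      binomialWeight ε l 0 * binomialWeight ε (l * (n + 1)) (n + 2) := by
    rw [step, sum_binomialWeight_mul_eq ε l (n + 2) _ fun b hb => if_neg (by omega),
      Finset.sum_range_succ']
    rw [Finset.sum_range_succ'] at hM' hV
    simp only [Nat.zero_sub, Nat.cast_zero, zero_mul, mul_zero, add_zero, Nat.add_sub_cancel,
      ite_self, Nat.sub_zero] at hM' hV ⊢
    rw [← hV, ← sub_eq_iff_eq_add', ← Finset.sum_sub_distrib] at hM'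
    rw [← hM']
    refine Finset.sum_congr rfl fun b hb => ?_
    have : b ≤ n + 1 := by simpa [Nat.lt_succ_iff] using hb
    rw [if_pos this, show n + 2 - (b + 1) = n + 1 - b by omega]
    push_cast
    ring
  have hch : (((l * (n + 1)).choose (n + 2) : ℕ) : ℝ) * (n + 2) =
      (((n + 1) * l).choose (n + 1) : ℝ) * ((n + 1) * (l - 1)) := by
    have h1 := congrArg (Nat.cast (R := ℝ)) (Nat.choose_succ_right_eq ((n + 1) * l) (n + 1))
    obtain ⟨m, rfl⟩ := Nat.exists_eq_add_of_le' hl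
    rw [show (n + 1) * (m + 1) - (n + 1) = (n + 1) * m by rw [mul_add, mul_one, Nat.add_sub_cancel]]
      at h1
    push_cast at h1 ⊢
    rw [mul_comm (m + 1) (n + 1)]
    linear_combination h1
  have hw : binomialWeight ε l 0 * binomialWeight ε (l * (n + 1)) (n + 2) =
      ((l * (n + 1)).choose (n + 2) : ℝ) * (ε ^ (n + 2) * (1 - ε) ^ ((n + 2) * (l - 1))) := by
    rw [binomialWeight_mul, Nat.choose_zero_right, one_mul, zero_add,
      show l + l * (n + 1) - (n + 2) = (n + 2) * (l - 1) by
        rw [Nat.mul_sub, mul_one]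
        congr 1
        ring]
  apply mul_left_cancel₀ hn
  rw [hsum, hw]
  have h2 : (n : ℝ) + 2 ≠ 0 := by positivity
  push_cast
  field_simp
  linear_combination (ε ^ (n + 2) * (1 - ε) ^ ((n + 2) * (l - 1))) * hch

lemma hasSum_periodSurvival {ε : ℝ} (h0 : 0 ≤ ε) (h1 : ε ≤ 1) {l : ℕ} (hlt : (l : ℝ) * ε < 1) :
    HasSum (periodSurvival ε l) ((1 - ε) ^ l / (1 - l * ε)) := by
  have hδ : 1 - (l : ℝ) * ε ≠ 0 := by linarith
  rw [← hasSum_nat_add_iff' 1]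
  have h := hasSum_sum fun b (_ : b ∈ Finset.range (l + 1)) =>
    (hasSum_survival h0 h1 hlt (b - 1)).mul_left (binomialWeight ε l b)
  have hs : ∑ b ∈ Finset.range (l + 1), binomialWeight ε l b * ((b - 1 : ℕ) : ℝ) =
      l * ε - 1 + (1 - ε) ^ l := by
    have hm := sum_binomialWeight_mul_cast ε l
    have ht := sum_binomialWeight ε l
    rw [Finset.sum_range_succ'] at hm ht ⊢
    rw [← hm, ← binomialWeight_zero_right]
    simp only [Nat.cast_add, Nat.cast_one, mul_add, mul_one, Finset.sum_add_distrib, Nat.zero_sub,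
      Nat.add_sub_cancel, Nat.cast_zero, mul_zero, add_zero]
    linarith
  have hv : (1 - ε) ^ l / (1 - l * ε) - ∑ i ∈ Finset.range 1, periodSurvival ε l i =
      ∑ b ∈ Finset.range (l + 1), binomialWeight ε l b * (((b - 1 : ℕ) : ℝ) / (1 - l * ε)) := by
    simp only [← mul_div_assoc]
    rw [← Finset.sum_div, hs, Finset.sum_range_one, periodSurvival, eq_div_iff hδ, sub_mul,
      div_mul_cancel₀ _ hδ]
    ring
  rw [hv]
  exact h

/-! ### Periods in terms of all erasures -/

/-- Number of erased packets, of either kind, in the slots `a + 1, …, b`. -/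
def erasures (e : ℕ → Bool) (a b : ℕ) : ℕ :=
  ((Finset.Ioc a b).filter fun t => e t = true).card

lemma erasures_add (e : ℕ → Bool) {a b c : ℕ} (hab : a ≤ b) (hbc : b ≤ c) :
    erasures e a b + erasures e b c = erasures e a c := by
  rw [erasures, erasures, erasures, ← Finset.Ioc_union_Ioc_eq_Ioc hab hbc, Finset.filter_union,
    Finset.card_union_of_disjoint]
  exact Finset.disjoint_filter_filter (Finset.Ioc_disjoint_Ioc_of_le le_rfl)

lemma erasures_le (e : ℕ → Bool) (a m : ℕ) : erasures e a (a + m) ≤ m :=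
  (Finset.card_filter_le _ _).trans (by simp)

lemma erasures_congr {e e' : ℕ → Bool} {a b : ℕ} (h : ∀ t ∈ Finset.Ioc a b, e t = e' t) :
    erasures e a b = erasures e' a b := by
  rw [erasures, erasures, Finset.filter_congr fun t ht => by rw [h t ht]]

lemma card_filter_dvd_Ioc {l a : ℕ} (hl : 1 ≤ l) (ha : l ∣ a) (k : ℕ) :
    ((Finset.Ioc a (a + k * l)).filter fun t => l ∣ t).card = k := by
  obtain ⟨c, rfl⟩ := ha
  have : ((Finset.Ioc (l * c) (l * c + k * l)).filter fun t => l ∣ t) =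
      (Finset.Ioc c (c + k)).image (l * ·) := by
    ext t
    simp only [Finset.mem_filter, Finset.mem_Ioc, Finset.mem_image]
    have hlk : l * c + k * l = l * (c + k) := by ring
    constructor
    · rintro ⟨⟨h1, h2⟩, ⟨d, rfl⟩⟩
      rw [hlk] at h2
      exact ⟨d, ⟨Nat.lt_of_mul_lt_mul_left h1, Nat.le_of_mul_le_mul_left h2 hl⟩, rfl⟩
    · rintro ⟨d, ⟨h1, h2⟩, rfl⟩
      rw [hlk]
      exact ⟨⟨Nat.mul_lt_mul_of_pos_left h1 hl, Nat.mul_le_mul_left l h2⟩, dvd_mul_right l d⟩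
  rw [this, Finset.card_image_of_injective _ fun x y h => Nat.eq_of_mul_eq_mul_left hl h]
  simp

/-- An erased coded packet costs as much as an erased information packet: the information erasures
are made up for after `k` blocks if and only if there are at most `k` erasures altogether. -/
lemma infoErasures_le_codedReceived_iff {l a : ℕ} (hl : 1 ≤ l) (ha : l ∣ a) (e : ℕ → Bool) (k : ℕ) :
    infoErasures l e a (a + k * l) ≤ codedReceived l e a (a + k * l) ↔
      erasures e a (a + k * l) ≤ k := by
  set I := Finset.Ioc a (a + k * l)
  have h1 : erasures e a (a + k * l) = infoErasures l e a (a + k * l) +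
      (I.filter fun t => l ∣ t ∧ e t = true).card := by
    rw [erasures, infoErasures, ← Finset.card_union_of_disjoint, ← Finset.filter_or]
    · congr 1
      refine Finset.filter_congr fun t _ => ?_
      tauto
    · exact Finset.disjoint_filter.2 fun t _ h h' => h.1 h'.1
  have h2 : k = codedReceived l e a (a + k * l) +
      (I.filter fun t => l ∣ t ∧ e t = true).card := by
    rw [codedReceived, ← Finset.card_union_of_disjoint, ← Finset.filter_or]
    · conv_lhs => rw [← card_filter_dvd_Ioc hl ha k]
      congr 1
      refine Finset.filter_congr fun t _ => ?_
      cases e t <;> simp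
    · exact Finset.disjoint_filter.2 fun t _ h h' => by simp [h.2] at h'
  omega

/-- The value `S⁺` of a period that begins just after slot `a`. -/
noncomputable def busyTimePlusFrom (l : ℕ) (e : ℕ → Bool) (a : ℕ) : ℕ∞ :=
  max (busyTimeFrom l e a) 1

/-- `S⁺` is the first `k ≥ 1` with at most `k` erasures in the first `k` blocks, for idle periods as
well as for busy ones. -/
lemma lt_busyTimePlusFrom_iff {l a : ℕ} (hl : 1 ≤ l) (ha : l ∣ a) (e : ℕ → Bool) (n : ℕ) :
    (n : ℕ∞) < busyTimePlusFrom l e a ↔ ∀ k < n, k + 1 < erasures e a (a + (k + 1) * l) := by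
  unfold busyTimePlusFrom busyTimeFrom
  split_ifs with h
  · rw [max_eq_right zero_le_one]
    rcases n with _ | n
    · simp
    · have h1 : erasures e a (a + 1 * l) ≤ 1 := by
        rw [← infoErasures_le_codedReceived_iff hl ha, one_mul, h]
        exact Nat.zero_le _
      have h2 : ¬ ((n + 1 : ℕ) : ℕ∞) < 1 := by
        rw [not_lt]
        exact_mod_cast Nat.le_add_left 1 n
      refine iff_of_false h2 fun h3 => ?_
      have := h3 0 n.succ_pos
      simp only [zero_add] at this
      omega
  · rw [max_eq_left (le_iInf₂ fun k hk => by exact_mod_cast hk.1),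
      ← ENat.add_one_le_iff (ENat.natCast_ne_top n), le_iInf₂_iff]
    simp only [infoErasures_le_codedReceived_iff hl ha]
    constructor
    · intro h' k hk
      by_contra! hc
      have := h' (k + 1) ⟨by omega, hc⟩
      norm_cast at this
      omega
    · rintro h' k ⟨hk, hc⟩
      norm_cast
      by_contra! hlt
      obtain ⟨m, rfl⟩ := Nat.exists_eq_add_of_le' hk
      have := h' m (by omega)
      omega

/-- The walk that starts at height `h` just after slot `a` is positive after `0, 1, …, n` blocks. -/
def StaysPositive (l : ℕ) (e : ℕ → Bool) (a h n : ℕ) : Prop :=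
  ∀ k ≤ n, k < h + erasures e a (a + k * l)

lemma not_staysPositive_zero (l : ℕ) (e : ℕ → Bool) (a n : ℕ) : ¬ StaysPositive l e a 0 n :=
  fun h => by simpa [erasures] using h 0 (Nat.zero_le n)

lemma staysPositive_succ_zero (l : ℕ) (e : ℕ → Bool) (a h : ℕ) : StaysPositive l e a (h + 1) 0 :=
  fun k hk => by omega

lemma erasures_add_block (l : ℕ) (e : ℕ → Bool) (a k : ℕ) :
    erasures e a (a + (k + 1) * l) =
      erasures e a (a + l) + erasures e (a + l) (a + l + k * l) := by
  rw [erasures_add e (by omega) (by omega)]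
  congr 1
  ring

lemma staysPositive_succ_succ (l : ℕ) (e : ℕ → Bool) (a h n : ℕ) :
    StaysPositive l e a (h + 1) (n + 1) ↔
      StaysPositive l e (a + l) (h + erasures e a (a + l)) n := by
  constructor
  · intro H k hk
    have := H (k + 1) (by omega)
    rw [erasures_add_block] at this
    omega
  · intro H k hk
    rcases k with _ | k
    · omega
    · have := H k (by omega)
      rw [erasures_add_block]
      omega

lemma succ_lt_busyTimePlusFrom_iff {l a : ℕ} (hl : 1 ≤ l) (ha : l ∣ a) (e : ℕ → Bool) (n : ℕ) :
    ((n + 1 : ℕ) : ℕ∞) < busyTimePlusFrom l e a ↔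
      StaysPositive l e (a + l) (erasures e a (a + l) - 1) n := by
  rw [lt_busyTimePlusFrom_iff hl ha]
  constructor
  · intro H k hk
    have h0 := H 0 (by omega)
    have := H k (by omega)
    rw [erasures_add_block] at this
    simp only [zero_add, one_mul] at h0
    omega
  · intro H k hk
    have h0 := H 0 (by omega)
    have := H k (by omega)
    rw [erasures_add_block]
    simp only [zero_mul, add_zero] at h0
    have h00 : erasures e (a + l) (a + l) = 0 := by simp [erasures]
    omega

lemma one_le_busyTimePlusFrom (l : ℕ) (e : ℕ → Bool) (a : ℕ) : 1 ≤ busyTimePlusFrom l e a :=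
  le_max_right _ _

/-! ### Beginnings of periods -/

lemma periodStart_succ (l : ℕ) (e : ℕ → Bool) (j : ℕ) :
    periodStart l e (j + 1) =
      if periodStart l e j = ⊤ ∨ busyTimePlusFrom l e (periodStart l e j).toNat = ⊤ then ⊤
      else periodStart l e j + busyTimePlusFrom l e (periodStart l e j).toNat * l := by
  rw [periodStart]
  have ht : busyTimePlusFrom l e (periodStart l e j).toNat = ⊤ ↔
      busyTimeFrom l e (periodStart l e j).toNat = ⊤ := by
    simp [busyTimePlusFrom, max_eq_top]
  simp only [ht]
  split_ifs with h1 h2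
  · rfl
  · simp [busyTimePlusFrom, h2]
  · rw [busyTimePlusFrom, max_eq_left (Order.one_le_iff_ne_zero.2 h2)]

lemma periodStart_succ_eq_coe_iff (l : ℕ) (e : ℕ → Bool) (j b : ℕ) :
    periodStart l e (j + 1) = b ↔
      ∃ a m : ℕ, periodStart l e j = a ∧ busyTimePlusFrom l e a = m ∧ b = a + m * l := by
  rw [periodStart_succ]
  constructor
  · intro h
    split_ifs at h with h1
    · exact absurd h.symm (ENat.natCast_ne_top b)
    · push Not at h1
      obtain ⟨a, ha⟩ := ENat.ne_top_iff_exists.1 h1.1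
      obtain ⟨m, hm⟩ := ENat.ne_top_iff_exists.1 h1.2
      rw [← ha, ENat.toNat_natCast] at hm
      rw [← ha, ENat.toNat_natCast, ← hm] at h
      refine ⟨a, m, ha.symm, hm.symm, ?_⟩
      exact_mod_cast h.symm
  · rintro ⟨a, m, ha, hm, rfl⟩
    rw [ha, ENat.toNat_natCast, hm]
    simp

lemma dvd_of_periodStart_eq {l : ℕ} {e : ℕ → Bool} {j a : ℕ} (h : periodStart l e j = a) :
    l ∣ a := by
  induction j generalizing a with
  | zero =>
    have h0 : ((0 : ℕ) : ℕ∞) = (a : ℕ∞) := h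
    rw [← Nat.cast_injective h0]
    exact dvd_zero l
  | succ j ih =>
    obtain ⟨a', m, h1, -, rfl⟩ := (periodStart_succ_eq_coe_iff l e j a).1 h
    exact dvd_add (ih h1) (dvd_mul_left l m)

/-! ### Events determined by finitely many slots -/

/-- Whether an erasure pattern has the property `P` is decided by the slots `a + 1, …, b`. -/
def DeterminedBy (P : (ℕ → Bool) → Prop) (a b : ℕ) : Prop :=
  ∀ e e' : ℕ → Bool, (∀ t ∈ Finset.Ioc a b, e t = e' t) → P e → P e'

lemma DeterminedBy.mono {P : (ℕ → Bool) → Prop} {a b a' b' : ℕ} (h : DeterminedBy P a b)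
    (ha : a' ≤ a) (hb : b ≤ b') : DeterminedBy P a' b' :=
  fun e e' he => h e e' fun t ht => he t (Finset.Ioc_subset_Ioc ha hb ht)

lemma DeterminedBy.and {P Q : (ℕ → Bool) → Prop} {a b : ℕ} (hP : DeterminedBy P a b)
    (hQ : DeterminedBy Q a b) : DeterminedBy (fun e => P e ∧ Q e) a b :=
  fun e e' he h => ⟨hP e e' he h.1, hQ e e' he h.2⟩

lemma DeterminedBy.not {P : (ℕ → Bool) → Prop} {a b : ℕ} (hP : DeterminedBy P a b) :
    DeterminedBy (fun e => ¬ P e) a b :=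
  fun e e' he h h' => h (hP e' e (fun t ht => (he t ht).symm) h')

lemma determinedBy_erasures_eq (a b c : ℕ) : DeterminedBy (fun e => erasures e a b = c) a b :=
  fun e e' he h => by rw [← h, erasures_congr he]

lemma determinedBy_eq (c : ℕ) (x : Bool) : DeterminedBy (fun e => e (c + 1) = x) c (c + 1) :=
  fun e e' he h => by rw [← h, he (c + 1) (by simp)]

lemma determinedBy_staysPositive (l a h n : ℕ) :
    DeterminedBy (fun e => StaysPositive l e a h n) a (a + n * l) := by
  intro e e' he H k hk
  have hkl : a + k * l ≤ a + n * l := Nat.add_le_add_left (Nat.mul_le_mul_right l hk) a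
  rw [← erasures_congr fun t ht => he t (Finset.Ioc_subset_Ioc_right hkl ht)]
  exact H k hk

lemma determinedBy_lt_busyTimePlusFrom {l a : ℕ} (hl : 1 ≤ l) (ha : l ∣ a) (n : ℕ) :
    DeterminedBy (fun e => (n : ℕ∞) < busyTimePlusFrom l e a) a (a + n * l) := by
  intro e e' he H
  rw [lt_busyTimePlusFrom_iff hl ha] at H ⊢
  intro k hk
  have hkl : a + (k + 1) * l ≤ a + n * l := Nat.add_le_add_left (Nat.mul_le_mul_right l hk) a
  rw [← erasures_congr fun t ht => he t (Finset.Ioc_subset_Ioc_right hkl ht)]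
  exact H k hk

lemma eq_coe_succ_iff (x : ℕ∞) (m : ℕ) :
    x = ((m + 1 : ℕ) : ℕ∞) ↔ (m : ℕ∞) < x ∧ ¬ ((m + 1 : ℕ) : ℕ∞) < x := by
  rw [not_lt, ← ENat.add_one_le_iff (ENat.natCast_ne_top m), ← Nat.cast_add_one, and_comm]
  exact le_antisymm_iff

lemma busyTimePlusFrom_ne_zero (l : ℕ) (e : ℕ → Bool) (a : ℕ) : busyTimePlusFrom l e a ≠ 0 :=
  Order.one_le_iff_ne_zero.1 (one_le_busyTimePlusFrom l e a)

lemma determinedBy_busyTimePlusFrom_eq {l a : ℕ} (hl : 1 ≤ l) (ha : l ∣ a) (m : ℕ) :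
    DeterminedBy (fun e => busyTimePlusFrom l e a = m) a (a + m * l) := by
  rcases m with _ | m
  · exact fun e e' _ h => absurd h (busyTimePlusFrom_ne_zero l e a)
  · simp only [eq_coe_succ_iff]
    exact ((determinedBy_lt_busyTimePlusFrom hl ha m).mono le_rfl
      (Nat.add_le_add_left (Nat.mul_le_mul_right l m.le_succ) a)).and
      (determinedBy_lt_busyTimePlusFrom hl ha (m + 1)).not

/-- Whether the `j`-th period begins just after slot `a` is decided by the slots up to `a`: these
beginnings are stopping times. -/
lemma determinedBy_periodStart_eq {l : ℕ} (hl : 1 ≤ l) (j a : ℕ) :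
    DeterminedBy (fun e => periodStart l e j = a) 0 a := by
  induction j generalizing a with
  | zero => exact fun e e' _ h => h
  | succ j ih =>
    intro e e' he h
    rw [periodStart_succ_eq_coe_iff] at h ⊢
    obtain ⟨a', m, h1, h2, rfl⟩ := h
    exact ⟨a', m, (ih a').mono le_rfl (Nat.le_add_right _ _) e e' he h1,
      (determinedBy_busyTimePlusFrom_eq hl (dvd_of_periodStart_eq h1) m).mono (Nat.zero_le _) le_rfl
        e e' he h2, rfl⟩

/-! ### The random erasure pattern -/

/-- The slots `1, 2, 3, …` are erased independently with probability `ε`. Nothing is assumed about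
the unused slot `0`. -/
structure IsErasureProcess {Ω : Type*} [MeasurableSpace Ω] (μ : Measure Ω) (E : ℕ → Ω → Bool)
    (ε : ℝ) : Prop where
  measurable : ∀ t : ℕ, Measurable (E (t + 1))
  indep : iIndepFun (fun t : ℕ => E (t + 1)) μ
  prob : ∀ t : ℕ, μ.real {ω | E (t + 1) ω = true} = ε

variable {Ω : Type*} [MeasurableSpace Ω] {μ : Measure Ω} {E : ℕ → Ω → Bool} {ε : ℝ}

lemma DeterminedBy.setOf_eq_preimage {α : Type*} {P : (ℕ → Bool) → Prop} {a b : ℕ}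
    (hP : DeterminedBy P a b) (E : ℕ → α → Bool) :
    {ω | P fun t => E t ω} = (fun ω (i : Finset.Ico a b) => E (i + 1) ω) ⁻¹'
      {x | ∃ e : ℕ → Bool, (∀ i : Finset.Ico a b, e (i + 1) = x i) ∧ P e} := by
  ext ω
  constructor
  · exact fun h => ⟨fun t => E t ω, fun i => rfl, h⟩
  · rintro ⟨e, he, h⟩
    refine hP e _ (fun t ht => ?_) h
    obtain ⟨h1, h2⟩ := Finset.mem_Ioc.1 ht
    obtain ⟨s, rfl⟩ := Nat.exists_eq_succ_of_ne_zero (show t ≠ 0 by omega)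
    exact he ⟨s, Finset.mem_Ico.2 ⟨by omega, by omega⟩⟩

lemma IsErasureProcess.measurableSet (hE : IsErasureProcess μ E ε) {P : (ℕ → Bool) → Prop}
    {a b : ℕ} (hP : DeterminedBy P a b) : MeasurableSet {ω | P fun t => E t ω} := by
  rw [hP.setOf_eq_preimage E]
  exact (measurable_pi_lambda _ fun i : Finset.Ico a b => hE.measurable i)
    (Set.toFinite _).measurableSet

/-- Events decided by disjoint ranges of slots are independent. -/
lemma IsErasureProcess.measure_and (hE : IsErasureProcess μ E ε) {P Q : (ℕ → Bool) → Prop}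
    {a b c : ℕ} (hP : DeterminedBy P a b) (hQ : DeterminedBy Q b c) :
    μ {ω | P (fun t => E t ω) ∧ Q fun t => E t ω} =
      μ {ω | P fun t => E t ω} * μ {ω | Q fun t => E t ω} := by
  have hd : Disjoint (Finset.Ico a b) (Finset.Ico b c) :=
    Finset.Ico_disjoint_Ico_consecutive a b c
  have h := hE.indep.indepFun_finset _ _ hd hE.measurable
  rw [Set.ofPred_and, hP.setOf_eq_preimage E, hQ.setOf_eq_preimage E]
  exact h.measure_inter_preimage_eq_mul _ _ (Set.toFinite _).measurableSet
    (Set.toFinite _).measurableSet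

lemma IsErasureProcess.measureReal_and (hE : IsErasureProcess μ E ε) {P Q : (ℕ → Bool) → Prop}
    {a b c : ℕ} (hP : DeterminedBy P a b) (hQ : DeterminedBy Q b c) :
    μ.real {ω | P (fun t => E t ω) ∧ Q fun t => E t ω} =
      μ.real {ω | P fun t => E t ω} * μ.real {ω | Q fun t => E t ω} := by
  simp only [measureReal_def, hE.measure_and hP hQ, ENNReal.toReal_mul]

lemma IsErasureProcess.eps_nonneg (hE : IsErasureProcess μ E ε) : 0 ≤ ε :=
  hE.prob 0 ▸ measureReal_nonneg

lemma IsErasureProcess.eps_le_one [IsProbabilityMeasure μ] (hE : IsErasureProcess μ E ε) : ε ≤ 1 :=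
  hE.prob 0 ▸ measureReal_le_one

lemma IsErasureProcess.measureReal_eq_false [IsProbabilityMeasure μ] (hE : IsErasureProcess μ E ε)
    (t : ℕ) :
    μ.real {ω | E (t + 1) ω = false} = 1 - ε := by
  have : {ω | E (t + 1) ω = false} = {ω | E (t + 1) ω = true}ᶜ := by
    ext ω
    simp
  rw [this, probReal_compl_eq_one_sub (hE.measurableSet (determinedBy_eq t true)), hE.prob]

/-- The number of erasures in `m` consecutive slots is binomially distributed. -/
lemma IsErasureProcess.measureReal_erasures_eq [IsProbabilityMeasure μ]
    (hE : IsErasureProcess μ E ε) (a m b : ℕ) :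
    μ.real {ω | erasures (fun t => E t ω) a (a + m) = b} = binomialWeight ε m b := by
  induction m generalizing b with
  | zero => rcases b with _ | b <;> simp [erasures, binomialWeight]
  | succ m ih =>
    have hstep : ∀ e : ℕ → Bool, erasures e a (a + (m + 1)) =
        erasures e a (a + m) + if e (a + m + 1) = true then 1 else 0 := fun e => by
      rw [← erasures_add e (show a ≤ a + m by omega) (show a + m ≤ a + (m + 1) by omega)]
      congr 1
      rw [erasures, ← add_assoc, Nat.Ioc_succ_singleton, Finset.filter_singleton]
      split_ifs <;> rfl
    have hand : ∀ (c : ℕ) (x : Bool),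
        μ.real {ω | erasures (fun t => E t ω) a (a + m) = c ∧ E (a + m + 1) ω = x} =
          binomialWeight ε m c * μ.real {ω | E (a + m + 1) ω = x} := fun c x => by
      rw [← ih]
      exact hE.measureReal_and (determinedBy_erasures_eq a (a + m) c) (determinedBy_eq (a + m) x)
    rcases b with _ | b
    · rw [binomialWeight_succ_zero, ← hE.measureReal_eq_false (a + m), ← hand]
      congr 1
      ext ω
      simp only [Set.mem_ofPred_eq, hstep]
      cases E (a + m + 1) ω <;> simp
    · rw [binomialWeight_succ_succ, ← hE.measureReal_eq_false (a + m), ← hand]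
      nth_rw 2 [← hE.prob (a + m)]
      rw [← hand, ← measureReal_union]
      · congr 1
        ext ω
        simp only [Set.mem_ofPred_eq, hstep, Set.mem_union]
        cases E (a + m + 1) ω <;> simp
      · refine Set.disjoint_left.2 fun ω h h' => ?_
        simp only [Set.mem_ofPred_eq] at h h'
        simp [h.2] at h'
      · exact hE.measurableSet (((determinedBy_erasures_eq a (a + m) (b + 1)).mono le_rfl
          (Nat.le_succ _)).and ((determinedBy_eq (a + m) false).mono (Nat.le_add_right a m) le_rfl))

/-- Conditioning on the number of erasures in the first block. -/
lemma IsErasureProcess.measureReal_block [IsProbabilityMeasure μ] (hE : IsErasureProcess μ E ε)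
    (l a c : ℕ)
    (Q : ℕ → (ℕ → Bool) → Prop) (hQ : ∀ b, DeterminedBy (Q b) (a + l) c) (hc : a + l ≤ c) :
    μ.real {ω | Q (erasures (fun t => E t ω) a (a + l)) fun t => E t ω} =
      ∑ b ∈ Finset.range (l + 1), binomialWeight ε l b * μ.real {ω | Q b fun t => E t ω} := by
  have hset : {ω | Q (erasures (fun t => E t ω) a (a + l)) fun t => E t ω} =
      ⋃ b ∈ Finset.range (l + 1),
        {ω | erasures (fun t => E t ω) a (a + l) = b ∧ Q b fun t => E t ω} := by
    ext ω
    simp only [Set.mem_iUnion, Set.mem_ofPred_eq, Finset.mem_range, exists_prop]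
    constructor
    · exact fun h => ⟨_, Nat.lt_succ_of_le (erasures_le _ a l), rfl, h⟩
    · rintro ⟨b, -, rfl, h⟩
      exact h
  rw [hset, measureReal_biUnion_finset]
  · refine Finset.sum_congr rfl fun b _ => ?_
    rw [← hE.measureReal_erasures_eq a l b]
    exact hE.measureReal_and (determinedBy_erasures_eq a (a + l) b) (hQ b)
  · intro b _ b' _ hbb
    exact Set.disjoint_left.2 fun ω h h' => hbb (h.1.symm.trans h'.1)
  · exact fun b _ => hE.measurableSet (((determinedBy_erasures_eq a (a + l) b).mono le_rfl hc).and
      ((hQ b).mono (Nat.le_add_right a l) le_rfl))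

lemma IsErasureProcess.measureReal_staysPositive [IsProbabilityMeasure μ]
    (hE : IsErasureProcess μ E ε) (l n h a : ℕ) :
    μ.real {ω | StaysPositive l (fun t => E t ω) a h n} = survival ε l n h := by
  induction n generalizing h a with
  | zero =>
    rcases h with _ | h
    · simp [not_staysPositive_zero]
    · simp [staysPositive_succ_zero]
  | succ n ih =>
    rcases h with _ | h
    · simp [not_staysPositive_zero]
    · simp only [staysPositive_succ_succ]
      rw [hE.measureReal_block l a _ (fun b e => StaysPositive l e (a + l) (h + b) n)
        (fun b => determinedBy_staysPositive l (a + l) (h + b) n) (Nat.le_add_right _ _),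
        survival_succ_succ]
      simp only [ih]

lemma IsErasureProcess.measureReal_lt_busyTimePlusFrom [IsProbabilityMeasure μ]
    (hE : IsErasureProcess μ E ε) {l a : ℕ}
    (hl : 1 ≤ l) (ha : l ∣ a) (n : ℕ) :
    μ.real {ω | (n : ℕ∞) < busyTimePlusFrom l (fun t => E t ω) a} = periodSurvival ε l n := by
  rcases n with _ | n
  · have : ∀ ω, ((0 : ℕ) : ℕ∞) < busyTimePlusFrom l (fun t => E t ω) a := fun ω =>
      lt_of_lt_of_le zero_lt_one (one_le_busyTimePlusFrom l _ a)
    simp only [this]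
    simp [periodSurvival]
  · simp only [succ_lt_busyTimePlusFrom_iff hl ha]
    rw [hE.measureReal_block l a _ (fun b e => StaysPositive l e (a + l) (b - 1) n)
      (fun b => determinedBy_staysPositive l (a + l) (b - 1) n) (Nat.le_add_right _ _),
      periodSurvival]
    simp only [hE.measureReal_staysPositive]

lemma IsErasureProcess.periodSurvival_nonneg [IsProbabilityMeasure μ] (hE : IsErasureProcess μ E ε)
    {l : ℕ} (hl : 1 ≤ l)
    (n : ℕ) : 0 ≤ periodSurvival ε l n := by
  rw [← hE.measureReal_lt_busyTimePlusFrom hl (dvd_zero l) n]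
  exact measureReal_nonneg

/-! ### The `j`-th period -/

lemma setOf_periodStart_ne_top {α : Type*} (l j : ℕ) (E : ℕ → α → Bool) :
    {ω | periodStart l (fun t => E t ω) j ≠ ⊤} =
      ⋃ a : ℕ, {ω | periodStart l (fun t => E t ω) j = a} := by
  ext ω
  simp only [Set.mem_ofPred_eq, Set.mem_iUnion, ENat.ne_top_iff_exists, eq_comm]

lemma IsErasureProcess.measurableSet_periodStart_eq (hE : IsErasureProcess μ E ε) {l : ℕ}
    (hl : 1 ≤ l) (j a : ℕ) : MeasurableSet {ω | periodStart l (fun t => E t ω) j = a} :=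
  hE.measurableSet (determinedBy_periodStart_eq hl j a)

lemma IsErasureProcess.measurableSet_periodStart_ne_top (hE : IsErasureProcess μ E ε) {l : ℕ}
    (hl : 1 ≤ l) (j : ℕ) : MeasurableSet {ω | periodStart l (fun t => E t ω) j ≠ ⊤} := by
  rw [setOf_periodStart_ne_top]
  exact MeasurableSet.iUnion fun a => hE.measurableSet_periodStart_eq hl j a

lemma IsErasureProcess.measurableSet_lt_busyTimePlusFrom (hE : IsErasureProcess μ E ε) {l a : ℕ}
    (hl : 1 ≤ l) (ha : l ∣ a) (n : ℕ) :
    MeasurableSet {ω | (n : ℕ∞) < busyTimePlusFrom l (fun t => E t ω) a} :=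
  hE.measurableSet (determinedBy_lt_busyTimePlusFrom hl ha n)

lemma busyTimePlus_eq {l : ℕ} {e : ℕ → Bool} {j a : ℕ} (h : periodStart l e j = a) :
    busyTimePlus l e j = busyTimePlusFrom l e a := by
  rw [busyTimePlus, busyTime, h, ENat.toNat_natCast, busyTimePlusFrom]

lemma busyTimePlus_eq_of_top {l : ℕ} {e : ℕ → Bool} {j : ℕ} (h : periodStart l e j = ⊤) :
    busyTimePlus l e j = busyTimePlusFrom l e 0 := by
  rw [busyTimePlus, busyTime, h, ENat.toNat_top, busyTimePlusFrom]

lemma setOf_periodStart_ne_top_and_lt {α : Type*} (l j n : ℕ) (E : ℕ → α → Bool) :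
    {ω | periodStart l (fun t => E t ω) j ≠ ⊤ ∧ (n : ℕ∞) < busyTimePlus l (fun t => E t ω) j} =
      ⋃ a : ℕ, {ω | periodStart l (fun t => E t ω) j = a ∧
        (n : ℕ∞) < busyTimePlusFrom l (fun t => E t ω) a} := by
  ext ω
  simp only [Set.mem_ofPred_eq, Set.mem_iUnion]
  constructor
  · rintro ⟨h, h'⟩
    obtain ⟨a, ha⟩ := ENat.ne_top_iff_exists.1 h
    exact ⟨a, ha.symm, busyTimePlus_eq ha.symm ▸ h'⟩
  · rintro ⟨a, ha, h'⟩
    exact ⟨ha ▸ ENat.natCast_ne_top a, busyTimePlus_eq ha ▸ h'⟩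

lemma IsErasureProcess.measurableSet_periodStart_eq_and_lt (hE : IsErasureProcess μ E ε) {l : ℕ}
    (hl : 1 ≤ l) (j n a : ℕ) :
    MeasurableSet {ω | periodStart l (fun t => E t ω) j = a ∧
      (n : ℕ∞) < busyTimePlusFrom l (fun t => E t ω) a} := by
  by_cases ha : l ∣ a
  · exact (hE.measurableSet_periodStart_eq hl j a).inter
      (hE.measurableSet_lt_busyTimePlusFrom hl ha n)
  · convert MeasurableSet.empty
    exact Set.eq_empty_of_forall_notMem fun ω h => ha (dvd_of_periodStart_eq h.1)

lemma IsErasureProcess.measurableSet_periodStart_ne_top_and_lt (hE : IsErasureProcess μ E ε)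
    {l : ℕ} (hl : 1 ≤ l) (j n : ℕ) :
    MeasurableSet {ω | periodStart l (fun t => E t ω) j ≠ ⊤ ∧
      (n : ℕ∞) < busyTimePlus l (fun t => E t ω) j} := by
  rw [setOf_periodStart_ne_top_and_lt]
  exact MeasurableSet.iUnion fun a => hE.measurableSet_periodStart_eq_and_lt hl j n a

lemma IsErasureProcess.measurableSet_lt_busyTimePlus (hE : IsErasureProcess μ E ε) {l : ℕ}
    (hl : 1 ≤ l) (j n : ℕ) :
    MeasurableSet {ω | (n : ℕ∞) < busyTimePlus l (fun t => E t ω) j} := by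
  have : {ω | (n : ℕ∞) < busyTimePlus l (fun t => E t ω) j} =
      {ω | periodStart l (fun t => E t ω) j ≠ ⊤ ∧ (n : ℕ∞) < busyTimePlus l (fun t => E t ω) j} ∪
        ({ω | periodStart l (fun t => E t ω) j ≠ ⊤}ᶜ ∩
          {ω | (n : ℕ∞) < busyTimePlusFrom l (fun t => E t ω) 0}) := by
    ext ω
    by_cases h : periodStart l (fun t => E t ω) j = ⊤
    · simp [h, busyTimePlus_eq_of_top h]
    · simp [h]
  rw [this]
  exact (hE.measurableSet_periodStart_ne_top_and_lt hl j n).union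
    ((hE.measurableSet_periodStart_ne_top hl j).compl.inter
      (hE.measurableSet_lt_busyTimePlusFrom hl (dvd_zero l) n))

lemma IsErasureProcess.measurable_busyTimePlus_toNat (hE : IsErasureProcess μ E ε) {l : ℕ}
    (hl : 1 ≤ l) (j : ℕ) :
    Measurable fun ω => (busyTimePlus l (fun t => E t ω) j).toNat := by
  have hgt := hE.measurableSet_lt_busyTimePlus hl j
  have htop : MeasurableSet {ω | busyTimePlus l (fun t => E t ω) j = ⊤} := by
    have : {ω | busyTimePlus l (fun t => E t ω) j = ⊤} =
        ⋂ n : ℕ, {ω | (n : ℕ∞) < busyTimePlus l (fun t => E t ω) j} := by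
      ext ω
      simp only [Set.mem_ofPred_eq, Set.mem_iInter]
      exact ENat.eq_top_iff_forall_gt
    rw [this]
    exact MeasurableSet.iInter hgt
  refine measurable_of_Ioi fun n => ?_
  have : (fun ω => (busyTimePlus l (fun t => E t ω) j).toNat) ⁻¹' Set.Ioi n =
      {ω | (n : ℕ∞) < busyTimePlus l (fun t => E t ω) j} \
        {ω | busyTimePlus l (fun t => E t ω) j = ⊤} := by
    ext ω
    simp only [Set.mem_preimage, Set.mem_Ioi, Set.mem_sdiff, Set.mem_ofPred_eq]
    rcases eq_or_ne (busyTimePlus l (fun t => E t ω) j) ⊤ with h | h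
    · simp [h]
    · obtain ⟨m, hm⟩ := ENat.ne_top_iff_exists.1 h
      simp [← hm]
  rw [this]
  exact (hgt n).diff htop

/-- The strong Markov property: whether a period begins is independent of how long it then
lasts. -/
lemma IsErasureProcess.measure_periodStart_ne_top_and_lt [IsProbabilityMeasure μ]
    (hE : IsErasureProcess μ E ε) {l : ℕ}
    (hl : 1 ≤ l) (j n : ℕ) :
    μ {ω | periodStart l (fun t => E t ω) j ≠ ⊤ ∧ (n : ℕ∞) < busyTimePlus l (fun t => E t ω) j} =
      μ {ω | periodStart l (fun t => E t ω) j ≠ ⊤} * ENNReal.ofReal (periodSurvival ε l n) := by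
  have hdisj : ∀ a b : ℕ, a ≠ b → ∀ ω, periodStart l (fun t => E t ω) j = a →
      periodStart l (fun t => E t ω) j ≠ b := fun a b hab ω h h' =>
    hab (by exact_mod_cast h.symm.trans h')
  rw [setOf_periodStart_ne_top_and_lt, setOf_periodStart_ne_top, measure_iUnion, measure_iUnion,
    ← ENNReal.tsum_mul_right]
  · refine tsum_congr fun a => ?_
    by_cases ha : l ∣ a
    · rw [← hE.measureReal_lt_busyTimePlusFrom hl ha n, ofReal_measureReal]
      exact hE.measure_and (determinedBy_periodStart_eq hl j a)
        (determinedBy_lt_busyTimePlusFrom hl ha n)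
    · have h1 : ∀ ω, ¬ periodStart l (fun t => E t ω) j = a := fun ω h =>
        ha (dvd_of_periodStart_eq h)
      simp [h1]
  · exact fun a b hab => Set.disjoint_left.2 fun ω h h' => hdisj a b hab ω h h'
  · exact fun a => hE.measurableSet_periodStart_eq hl j a
  · exact fun a b hab => Set.disjoint_left.2 fun ω h h' => hdisj a b hab ω h.1 h'.1
  · exact fun a => hE.measurableSet_periodStart_eq_and_lt hl j n a

lemma IsErasureProcess.cond_busyTimePlus_eq_succ [IsProbabilityMeasure μ]
    (hE : IsErasureProcess μ E ε) {l : ℕ}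
    (hl : 1 ≤ l) (j n : ℕ) (h0 : μ {ω | periodStart l (fun t => E t ω) j ≠ ⊤} ≠ 0) :
    (μ[|{ω | periodStart l (fun t => E t ω) j ≠ ⊤}]).real
        {ω | busyTimePlus l (fun t => E t ω) j = ((n + 1 : ℕ) : ℕ∞)} =
      periodSurvival ε l n - periodSurvival ε l (n + 1) := by
  have hm : ∀ k : ℕ,
      μ.real ({ω | periodStart l (fun t => E t ω) j ≠ ⊤} ∩
        {ω | (k : ℕ∞) < busyTimePlus l (fun t => E t ω) j}) =
      μ.real {ω | periodStart l (fun t => E t ω) j ≠ ⊤} * periodSurvival ε l k := fun k => by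
    rw [← Set.ofPred_and, measureReal_def, hE.measure_periodStart_ne_top_and_lt hl j k,
      ENNReal.toReal_mul, ENNReal.toReal_ofReal (hE.periodSurvival_nonneg hl k), measureReal_def]
  have hset : {ω | busyTimePlus l (fun t => E t ω) j = ((n + 1 : ℕ) : ℕ∞)} =
      {ω | (n : ℕ∞) < busyTimePlus l (fun t => E t ω) j} \
        {ω | ((n + 1 : ℕ) : ℕ∞) < busyTimePlus l (fun t => E t ω) j} := by
    ext ω
    exact eq_coe_succ_iff _ n
  have hsub : {ω | ((n + 1 : ℕ) : ℕ∞) < busyTimePlus l (fun t => E t ω) j} ⊆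
      {ω | (n : ℕ∞) < busyTimePlus l (fun t => E t ω) j} :=
    fun ω (h : ((n + 1 : ℕ) : ℕ∞) < busyTimePlus l (fun t => E t ω) j) =>
      lt_of_le_of_lt (Nat.cast_le.2 n.le_succ) h
  have h0' : μ.real {ω | periodStart l (fun t => E t ω) j ≠ ⊤} ≠ 0 :=
    (measureReal_ne_zero_iff).2 h0
  rw [measureReal_def, cond_apply (hE.measurableSet_periodStart_ne_top hl j), ENNReal.toReal_mul,
    ENNReal.toReal_inv, ← measureReal_def, ← measureReal_def, hset, Set.inter_sdiff_distrib_left,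
    measureReal_sdiff (Set.inter_subset_inter_right _ hsub)
      ((hE.measurableSet_periodStart_ne_top hl j).inter
        (hE.measurableSet_lt_busyTimePlus hl j (n + 1))), hm, hm, ← mul_sub,
    inv_mul_cancel_left₀ h0']

/-- Below the critical erasure rate, a period that begins almost surely ends. -/
lemma IsErasureProcess.ae_busyTimePlus_ne_top [IsProbabilityMeasure μ] (hE : IsErasureProcess μ E ε)
    {l : ℕ} (hl : 1 ≤ l)
    (hlt : (l : ℝ) * ε < 1) (j : ℕ) (hj : ∀ᵐ ω ∂μ, periodStart l (fun t => E t ω) j ≠ ⊤) :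
    ∀ᵐ ω ∂μ, busyTimePlus l (fun t => E t ω) j ≠ ⊤ := by
  have hzero : μ {ω | periodStart l (fun t => E t ω) j ≠ ⊤ ∧
      busyTimePlus l (fun t => E t ω) j = ⊤} = 0 := by
    have hle : ∀ n : ℕ, μ {ω | periodStart l (fun t => E t ω) j ≠ ⊤ ∧
        busyTimePlus l (fun t => E t ω) j = ⊤} ≤ ENNReal.ofReal (periodSurvival ε l n) := by
      intro n
      refine (measure_mono fun ω h => ?_).trans
        ((hE.measure_periodStart_ne_top_and_lt hl j n).trans_le
          (mul_le_of_le_one_left (zero_le) prob_le_one))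
      exact ⟨h.1, h.2 ▸ ENat.natCast_lt_top n⟩
    have hlim := ENNReal.tendsto_ofReal
      (hasSum_periodSurvival hE.eps_nonneg hE.eps_le_one hlt).summable.tendsto_atTop_zero
    rw [ENNReal.ofReal_zero] at hlim
    exact le_antisymm (ge_of_tendsto' hlim hle) (zero_le)
  filter_upwards [hj, measure_eq_zero_iff_ae_notMem.1 hzero] with ω h1 h2 h3
  exact h2 ⟨h1, h3⟩

lemma IsErasureProcess.ae_periodStart_ne_top [IsProbabilityMeasure μ] (hE : IsErasureProcess μ E ε)
    {l : ℕ} (hl : 1 ≤ l)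
    (hlt : (l : ℝ) * ε < 1) (j : ℕ) : ∀ᵐ ω ∂μ, periodStart l (fun t => E t ω) j ≠ ⊤ := by
  induction j with
  | zero => exact Filter.Eventually.of_forall fun ω => ENat.natCast_ne_top 0
  | succ j ih =>
    filter_upwards [ih, hE.ae_busyTimePlus_ne_top hl hlt j ih] with ω h1 h2
    obtain ⟨a, ha⟩ := ENat.ne_top_iff_exists.1 h1
    rw [busyTimePlus_eq ha.symm] at h2
    obtain ⟨m, hm⟩ := ENat.ne_top_iff_exists.1 h2
    rw [(periodStart_succ_eq_coe_iff l _ j _).2 ⟨a, m, ha.symm, hm.symm, rfl⟩]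
    exact ENat.natCast_ne_top _

lemma natCast_eq_tsum_ite (m : ℕ) : (m : ENNReal) = ∑' n : ℕ, if n < m then 1 else 0 := by
  rw [tsum_eq_sum (s := Finset.range m) fun n hn => if_neg (by simpa using hn),
    Finset.sum_congr rfl fun n hn => if_pos (Finset.mem_range.1 hn)]
  simp

/-- The mean of `S⁺` as the sum of its tail probabilities. -/
lemma IsErasureProcess.lintegral_busyTimePlus [IsProbabilityMeasure μ] (hE : IsErasureProcess μ E ε)
    {l : ℕ} (hl : 1 ≤ l)
    (hlt : (l : ℝ) * ε < 1) (j : ℕ) :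
    ∫⁻ ω, ((busyTimePlus l (fun t => E t ω) j).toNat : ENNReal) ∂μ =
      ENNReal.ofReal ((1 - ε) ^ l / (1 - l * ε)) := by
  have hj := hE.ae_periodStart_ne_top hl hlt j
  have htail : ∀ n : ℕ, μ {ω | (n : ℕ∞) < busyTimePlus l (fun t => E t ω) j} =
      ENNReal.ofReal (periodSurvival ε l n) := fun n => by
    have h1 : μ {ω | periodStart l (fun t => E t ω) j ≠ ⊤} = 1 :=
      (prob_compl_eq_zero_iff (hE.measurableSet_periodStart_ne_top hl j)).1 hj
    rw [← one_mul (ENNReal.ofReal _), ← h1, ← hE.measure_periodStart_ne_top_and_lt hl j n]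
    refine measure_congr ?_
    filter_upwards [hj] with ω h
    exact propext ⟨fun h' => ⟨h, h'⟩, fun h' => h'.2⟩
  have hsum := hasSum_periodSurvival hE.eps_nonneg hE.eps_le_one hlt
  calc ∫⁻ ω, ((busyTimePlus l (fun t => E t ω) j).toNat : ENNReal) ∂μ
      = ∫⁻ ω, ∑' n : ℕ, {ω | (n : ℕ∞) < busyTimePlus l (fun t => E t ω) j}.indicator 1 ω ∂μ := by
        refine lintegral_congr_ae ?_
        filter_upwards [hE.ae_busyTimePlus_ne_top hl hlt j hj] with ω h
        obtain ⟨m, hm⟩ := ENat.ne_top_iff_exists.1 h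
        simp only [Set.indicator_apply, Set.mem_ofPred_eq, ← hm, ENat.toNat_natCast, Nat.cast_lt,
          Pi.one_apply]
        exact natCast_eq_tsum_ite m
    _ = ∑' n : ℕ, μ {ω | (n : ℕ∞) < busyTimePlus l (fun t => E t ω) j} := by
        rw [lintegral_tsum fun n =>
          (measurable_one.indicator (hE.measurableSet_lt_busyTimePlus hl j n)).aemeasurable]
        exact tsum_congr fun n => lintegral_indicator_one (hE.measurableSet_lt_busyTimePlus hl j n)
    _ = ENNReal.ofReal ((1 - ε) ^ l / (1 - l * ε)) := by
        simp only [htail]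
        rw [← ENNReal.ofReal_tsum_of_nonneg (hE.periodSurvival_nonneg hl) hsum.summable,
          hsum.tsum_eq]

end StreamCode

theorem corollary1 {Ω : Type*} [MeasurableSpace Ω] (μ : Measure Ω) [IsProbabilityMeasure μ]
    (l : ℕ) (hl : 1 ≤ l) (ε : ℝ) (E : ℕ → Ω → Bool)
    (hmeas : ∀ t : ℕ, Measurable (E (t + 1)))
    (hindep : iIndepFun (fun t : ℕ => E (t + 1)) μ)
    (hε : ∀ t : ℕ, μ.real {ω | E (t + 1) ω = true} = ε)
    (j : ℕ) :
    -- I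
    ((l : ℝ) * ε < 1 →
      (∀ᵐ ω ∂μ, StreamCode.periodStart l (fun t => E t ω) j ≠ ⊤) ∧
      (∀ᵐ ω ∂μ, StreamCode.busyTimePlus l (fun t => E t ω) j ≠ ⊤) ∧
      Integrable (fun ω => ((StreamCode.busyTimePlus l (fun t => E t ω) j).toNat : ℝ)) μ) ∧
    -- II
    (μ {ω | StreamCode.periodStart l (fun t => E t ω) j ≠ ⊤} ≠ 0 →
      ∀ s : ℕ,
        (μ[|{ω | StreamCode.periodStart l (fun t => E t ω) j ≠ ⊤}]).real
            {ω | StreamCode.busyTimePlus l (fun t => E t ω) j = (s : ℕ∞)} =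
          if s = 1 then ((l : ℝ) * ε + 1 - ε) * (1 - ε) ^ (l - 1)
          else if 1 < s then
            ((l : ℝ) - 1) / (s : ℝ) * ε ^ s * (1 - ε) ^ (s * (l - 1)) *
              (Nat.choose ((s - 1) * l) (s - 1) : ℝ)
          else 0) ∧
    -- III
    ((l : ℝ) * ε < 1 →
      ∫ ω, ((StreamCode.busyTimePlus l (fun t => E t ω) j).toNat : ℝ) ∂μ =
        (1 - ε) ^ l / (1 - (l : ℝ) * ε)) := by
  have hE : StreamCode.IsErasureProcess μ E ε := ⟨hmeas, hindep, hε⟩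
  have hmeasS : Measurable fun ω =>
      ((StreamCode.busyTimePlus l (fun t => E t ω) j).toNat : ℝ) :=
    measurable_from_nat.comp (hE.measurable_busyTimePlus_toNat hl j)
  have hcast : ∀ m : ℕ, ENNReal.ofReal (m : ℝ) = m := ENNReal.ofReal_natCast
  refine ⟨fun hlt => ?_, fun h0 s => ?_, fun hlt => ?_⟩
  · have hj := hE.ae_periodStart_ne_top hl hlt j
    refine ⟨hj, hE.ae_busyTimePlus_ne_top hl hlt j hj, hmeasS.aestronglyMeasurable, ?_⟩
    rw [hasFiniteIntegral_iff_ofReal (Filter.Eventually.of_forall fun ω => Nat.cast_nonneg _)]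
    simp only [hcast]
    rw [hE.lintegral_busyTimePlus hl hlt j]
    exact ENNReal.ofReal_lt_top
  · rcases s with _ | _ | n
    · have hempty : {ω | StreamCode.busyTimePlus l (fun t => E t ω) j = ((0 : ℕ) : ℕ∞)} = ∅ :=
        Set.eq_empty_of_forall_notMem fun ω => StreamCode.busyTimePlusFrom_ne_zero l _ _
      rw [hempty]
      simp
    · rw [hE.cond_busyTimePlus_eq_succ hl j 0 h0, StreamCode.periodSurvival_zero_sub_one ε hl,
        if_pos rfl]
    · rw [hE.cond_busyTimePlus_eq_succ hl j (n + 1) h0, StreamCode.periodSurvival_sub_succ ε hl,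
        if_neg (by omega), if_pos (by omega)]
      rfl
  · rw [integral_eq_lintegral_of_nonneg_ae (Filter.Eventually.of_forall fun ω => Nat.cast_nonneg _)
      hmeasS.aestronglyMeasurable]
    simp only [hcast]
    rw [hE.lintegral_busyTimePlus hl hlt j]
    have h1 : 0 ≤ 1 - ε := sub_nonneg.2 hE.eps_le_one
    have h2 : 0 ≤ 1 - (l : ℝ) * ε := by linarith
    exact ENNReal.toReal_ofReal (by positivity)
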